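/- Let $d\ge 1$, $\alpha>0$, and let $\xi$ be a random variable (with the common law of the i.i.d. variables $\xi_z$, $z\in\mathbb Z^d$) such that $0\le\xi\le 1$ almost surely, $\mathbf E\,\xi>0$ and $\mathbf P\{\xi=0\}\le p$, where $0<p\le 1$. Put $\nu=\ln(1/p)$. Let $\mathbf H^1(\mathbb R^d)$ be the closure of the compactly supported smooth vector fields $\phi:\mathbb R^d\to\mathbb R^d$ in the norm $(\|\phi\|_2^2+\|\nabla\phi\|_2^2)^{1/2}$. For $\phi\in\mathbf H^1(\mathbb R^d)$, $h>0$, $D\in\mathbb R$ put $$\mathcal K_\alpha(\phi)=\int_{\mathbb R^d}\Big(|\nabla\phi|^2+\alpha^{-1}(\operatorname{div}\phi)^2\Big)dx,\qquad |\nabla\phi|^2=\sum_{j,k=1}^d(\nabla_j\phi^{(k)})^2,$$ $$G(u)=-\ln\mathbf E\,e^{-u\xi},\qquad \Gamma(h;\phi)=\int_{\mathbb R^d}G(h|\phi(x)|^2)\,dx,\qquad \mathcal G(\phi;D)=\sup_{h>0}h^{-1}\big(\Gamma(h;\phi)-D\big),$$ and, with $|A|$ the Lebesgue measure of $A$, $$\mathcal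 C_\alpha=\inf\{\|\phi\|_2^{-2}\mathcal K_\alpha(\phi):\ \phi\in\mathbf H^1(\mathbb R^d),\ |\{\phi\ne0\}|=1\},$$ $$\mathcal C_{\alpha,\beta}=\inf\{\mathcal K_\alpha(\phi)+\beta\,\mathcal G(\phi;d):\ \phi\in\mathbf H^1(\mathbb R^d),\ \|\phi\|_2=1\}.$$ If $\mathbf P\{\xi=0\}=p$, then $$\lim_{\beta\to\infty}\mathcal C_{\alpha,\beta}=\Big(\frac{\nu}{d}\Big)^{2/d}\mathcal C_\alpha .$$ If only $\mathbf P\{\xi=0\}\le p$, the lower half of this still holds: $$\liminf_{\beta\to\infty}\mathcal C_{\alpha,\beta}\ \ge\ \Big(\frac{\nu}{d}\Big)^{2/d}\mathcal C_\alpha .$$ -/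

import Mathlib

open MeasureTheory Filter Topology
open scoped ContDiff ENNReal

namespace StokesPE

noncomputable section

/-- The Euclidean space `ℝ^d`. -/
abbrev Space (d : ℕ) : Type := EuclideanSpace ℝ (Fin d)

/-- The vector field `φ` belongs to `H¹(ℝ^d; ℝ^d)` and `g` is its gradient (`g x` is the linear map
`v ↦ ∑ j, v j • ∇_j φ (x)`): the pair `(φ, g)` is in the closure, in `L² × L²`, of the set of pairs
`(u, ∇u)` with `u` a compactly supported smooth vector field. The operator norm, which measures
gradients here, is equivalent to the Hilbert-Schmidt norm, so this is the closure of
`C_c^∞` in the norm `(‖φ‖₂² + ‖∇φ‖₂²)^(1/2)`. -/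
structure HasH1Gradient {d : ℕ} (φ : Space d → Space d) (g : Space d → Space d →L[ℝ] Space d) :
    Prop where
  memLp : MemLp φ 2 volume
  memLp_grad : MemLp g 2 volume
  mem_closure : ∃ u : ℕ → Space d → Space d,
    (∀ n, ContDiff ℝ ∞ (u n) ∧ HasCompactSupport (u n)) ∧
    Tendsto (fun n => eLpNorm (fun x => u n x - φ x) 2 volume) atTop (𝓝 0) ∧
    Tendsto (fun n => eLpNorm (fun x => fderiv ℝ (u n) x - g x) 2 volume) atTop (𝓝 0)

/-- The entry `∇_j φ^(k)` of a gradient. -/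
def entry {d : ℕ} (A : Space d →L[ℝ] Space d) (j k : Fin d) : ℝ :=
  A (EuclideanSpace.single j 1) k

/-- The density `|∇φ|² + α⁻¹ (div φ)²` as a function of the gradient. -/
def energyDensity {d : ℕ} (α : ℝ) (A : Space d →L[ℝ] Space d) : ℝ :=
  (∑ j, ∑ k, entry A j k ^ 2) + α⁻¹ * (∑ j, entry A j j) ^ 2

/-- The functional `𝒦_α(φ)`, as a function of the gradient `g` of `φ`. -/
def energy {d : ℕ} (α : ℝ) (g : Space d → Space d →L[ℝ] Space d) : ℝ :=
  ∫ x, energyDensity α (g x)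

/-- The squared norm `‖φ‖₂²`. -/
def normSq {d : ℕ} (φ : Space d → Space d) : ℝ := ∫ x, ‖φ x‖ ^ 2

/-- The constant `𝒞_α`: the infimum of `‖φ‖₂⁻² 𝒦_α(φ)` over `φ ∈ H¹` whose set of non-zero values
has measure one. -/
def C (d : ℕ) (α : ℝ) : ℝ :=
  sInf {r | ∃ (φ : Space d → Space d) (g : Space d → Space d →L[ℝ] Space d),
    HasH1Gradient φ g ∧ volume {x | φ x ≠ 0} = 1 ∧ r = (normSq φ)⁻¹ * energy α g}

section Potential

variable {Ω : Type*} [MeasurableSpace Ω]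

/-- `G(u) = -ln E exp(-u ξ)`. -/
def G (P : Measure Ω) (ξ : Ω → ℝ) (u : ℝ) : ℝ := -Real.log (∫ w, Real.exp (-u * ξ w) ∂P)

/-- `Γ(h; φ) = ∫ G(h |φ(x)|²) dx`. -/
def Gam (P : Measure Ω) (ξ : Ω → ℝ) {d : ℕ} (h : ℝ) (φ : Space d → Space d) : ℝ :=
  ∫ x, G P ξ (h * ‖φ x‖ ^ 2)

/-- `𝒢(φ; D) = sup_{h > 0} h⁻¹ (Γ(h; φ) - D)`. For `ξ` with values in `[0, 1]`, `φ ∈ L²` and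
`D ≥ 0` the values of `Γ` are convergent integrals and the supremum is finite, since
`0 ≤ G(u) ≤ u E ξ` for `u ≥ 0`. -/
def calG (P : Measure Ω) (ξ : Ω → ℝ) {d : ℕ} (φ : Space d → Space d) (D : ℝ) : ℝ :=
  ⨆ h : Set.Ioi (0 : ℝ), (h : ℝ)⁻¹ * (Gam P ξ h φ - D)

/-- The constant `𝒞_{α,β}`: the infimum of `𝒦_α(φ) + β 𝒢(φ; d)` over `φ ∈ H¹`, `‖φ‖₂ = 1`. -/
def Cab (P : Measure Ω) (ξ : Ω → ℝ) (d : ℕ) (α β : ℝ) : ℝ :=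
  sInf {r | ∃ (φ : Space d → Space d) (g : Space d → Space d →L[ℝ] Space d),
    HasH1Gradient φ g ∧ normSq φ = 1 ∧ r = energy α g + β * calG P ξ φ d}

end Potential

end

end StokesPE

/-!
# The limit of `𝒞_{α,β}` as `β → ∞`

Both `𝒦_α` and the norm scale, so the definition of `𝒞_α` says that
`𝒦_α(φ) ≥ m^(-2/d) 𝒞_α ‖φ‖₂²` whenever the support of `φ ∈ H¹` has measure at most `m`
(`C_mul_normSq_le_energy`). The limit is this bound for the critical measure `m = d / ν`.

*Upper bound* (`Cab_le`). If `P{ξ = 0} = p`, then `G ≤ ν`. A field admissible for `𝒞_α`, rescaled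
to a support of measure `d / ν`, satisfies `Γ(h; φ) ≤ d` for all `h`, so `𝒢(φ; d) ≤ 0` and the
penalty can only help.

*Lower bound* (`eventually_lt_Cab`). For large `β` only fields with `𝒢(φ; d) ≤ δ`, `δ` small,
matter, that is, `Γ(h; φ) ≤ d + h δ` for all `h`. Two values of `h` are used. As `G(u) ≥ u E ξ / 2`
on `[0, 1]`, the mass of `φ` on `{|φ|² ≤ b}` is small for a suitable `b`
(`setIntegral_norm_sq_le`). As `G(u)` nearly reaches `ν` for large `u`, the set `{|φ|² > a}` has
measure at most slightly more than `d / ν`, for any given `a` (`measure_lt_norm_sq_le`). It remains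
to cut off the small values of `φ`, between `a` and `b`. The divergence term rules out a plain
truncation `(1 - s / |v|)₊ v`, whose derivative is far from a multiple of the identity near
`|v| = s` and may turn an arbitrary gradient entry into divergence. A cutoff that varies slowly on
a logarithmic scale, `χ(κ log |v|²) v`, has as its derivative the multiple `χ` of the identity plus
an error `O(κ)`, so that it multiplies the energy by at most `1 + O(κ)`
(`exists_cutoff_energy_le`); it applies in `H¹` by the chain rule `HasH1Gradient.comp`. No
compactness is needed, since all estimates are uniform in `φ`.
-/

namespace StokesPE

/-! ### Rescaling and the constant `𝒞_α` -/

section Scaling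

variable {d : ℕ}

theorem map_smul_volume {r : ℝ} (hr : 0 < r) :
    Measure.map (fun x : Space d => r • x) volume = ENNReal.ofReal ((r ^ d)⁻¹) • volume := by
  have h := Measure.map_addHaar_smul (volume : Measure (Space d)) hr.ne'
  rwa [finrank_euclideanSpace_fin, abs_of_pos (by positivity)] at h

theorem measurableEmbedding_smul {r : ℝ} (hr : 0 < r) :
    MeasurableEmbedding (fun x : Space d => r • x) :=
  (Homeomorph.smulOfNeZero r hr.ne').measurableEmbedding

theorem integral_comp_smul_pos {r : ℝ} (hr : 0 < r) (f : Space d → ℝ) :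
    ∫ x, f (r • x) = (r ^ d)⁻¹ * ∫ x, f x := by
  have h := Measure.integral_comp_smul (volume : Measure (Space d)) f r
  rwa [finrank_euclideanSpace_fin, abs_of_pos (by positivity), smul_eq_mul] at h

theorem eLpNorm_comp_smul {E : Type*} [NormedAddCommGroup E] {r : ℝ} (hr : 0 < r)
    (f : Space d → E) :
    eLpNorm (fun x => f (r • x)) 2 volume
      = ENNReal.ofReal ((r ^ d)⁻¹) ^ (1 / (2 : ℝ≥0∞)).toReal * eLpNorm f 2 volume := by
  have h := (measurableEmbedding_smul (d := d) hr).eLpNorm_map_measure (g := f) (p := 2)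
    (μ := volume)
  rw [map_smul_volume hr, eLpNorm_smul_measure_of_ne_zero (by simpa using by positivity)] at h
  exact h.symm

theorem memLp_comp_smul {E : Type*} [NormedAddCommGroup E] {r : ℝ} (hr : 0 < r)
    {f : Space d → E} (hf : MemLp f 2 volume) : MemLp (fun x => f (r • x)) 2 volume := by
  have h := (measurableEmbedding_smul (d := d) hr).memLp_map_measure_iff (g := f) (p := 2)
    (μ := volume)
  rw [map_smul_volume hr] at h
  exact h.1 (hf.smul_measure ENNReal.ofReal_ne_top)

theorem tendsto_eLpNorm_const_smul_comp_smul {E : Type*} [NormedAddCommGroup E]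
    [NormedSpace ℝ E] {r : ℝ} (hr : 0 < r) (c : ℝ) {f : ℕ → Space d → E}
    (hf : Tendsto (fun n => eLpNorm (f n) 2 volume) atTop (𝓝 0)) :
    Tendsto (fun n => eLpNorm (fun x => c • f n (r • x)) 2 volume) atTop (𝓝 0) := by
  have h (n : ℕ) : eLpNorm (fun x => c • f n (r • x)) 2 volume
      = ‖c‖ₑ * ENNReal.ofReal ((r ^ d)⁻¹) ^ (1 / (2 : ℝ≥0∞)).toReal
        * eLpNorm (f n) 2 volume := by
    have := eLpNorm_const_smul c (fun x => f n (r • x)) 2 (volume : Measure (Space d))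
    rw [mul_assoc, ← eLpNorm_comp_smul hr, ← this]
    rfl
  simp_rw [h]
  have := ENNReal.Tendsto.const_mul (a := ‖c‖ₑ * ENNReal.ofReal ((r ^ d)⁻¹) ^
    (1 / (2 : ℝ≥0∞)).toReal) hf (Or.inr (ENNReal.mul_ne_top enorm_ne_top
      (ENNReal.rpow_ne_top_of_nonneg (by positivity) ENNReal.ofReal_ne_top)))
  simpa using this

/-- `H¹` is invariant under the rescaling `φ ↦ c φ(r ·)`. -/
theorem HasH1Gradient.comp_smul {φ : Space d → Space d} {g : Space d → Space d →L[ℝ] Space d}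
    (h : HasH1Gradient φ g) {r : ℝ} (hr : 0 < r) (c : ℝ) :
    HasH1Gradient (fun x => c • φ (r • x)) (fun x => (c * r) • g (r • x)) := by
  refine ⟨(memLp_comp_smul hr h.memLp).const_smul c,
    (memLp_comp_smul hr h.memLp_grad).const_smul (c * r), ?_⟩
  obtain ⟨u, hu, hφ, hg⟩ := h.mem_closure
  refine ⟨fun n x => c • u n (r • x), fun n => ⟨?_, ?_⟩, ?_, ?_⟩
  · exact ((hu n).1.comp (contDiff_const_smul r)).const_smul c
  · exact ((hu n).2.comp_homeomorph (Homeomorph.smulOfNeZero r hr.ne')).comp_left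
      (g := fun v => c • v) (smul_zero c)
  · simpa only [← smul_sub] using tendsto_eLpNorm_const_smul_comp_smul hr c hφ
  · convert tendsto_eLpNorm_const_smul_comp_smul hr (c * r) hg using 4 with n x
    have hd : DifferentiableAt ℝ (fun x => u n (r • x)) x :=
      (((hu n).1.comp (contDiff_const_smul r)).differentiable (by simp)).differentiableAt
    rw [fderiv_fun_const_smul hd, fderiv_comp_smul, smul_sub, mul_smul, mul_smul]

theorem normSq_nonneg (φ : Space d → Space d) : 0 ≤ normSq φ :=
  integral_nonneg fun _ => by positivity

theorem normSq_comp_smul (φ : Space d → Space d) {r : ℝ} (hr : 0 < r) (c : ℝ) :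
    normSq (fun x => c • φ (r • x)) = c ^ 2 * (r ^ d)⁻¹ * normSq φ := by
  unfold normSq
  simp_rw [norm_smul, mul_pow, integral_const_mul, Real.norm_eq_abs, sq_abs]
  rw [integral_comp_smul_pos hr (fun x => ‖φ x‖ ^ 2), mul_assoc]

theorem energyDensity_smul (α c : ℝ) (A : Space d →L[ℝ] Space d) :
    energyDensity α (c • A) = c ^ 2 * energyDensity α A := by
  have h (j k : Fin d) : entry (c • A) j k = c * entry A j k := by simp [entry]
  simp only [energyDensity, h, mul_pow, ← Finset.mul_sum]
  ring

theorem energyDensity_nonneg {α : ℝ} (hα : 0 < α) (A : Space d →L[ℝ] Space d) :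
    0 ≤ energyDensity α A := by
  unfold energyDensity
  positivity

theorem energy_nonneg {α : ℝ} (hα : 0 < α) (g : Space d → Space d →L[ℝ] Space d) :
    0 ≤ energy α g :=
  integral_nonneg fun _ => energyDensity_nonneg hα _

theorem energy_comp_smul (α : ℝ) (g : Space d → Space d →L[ℝ] Space d) {r : ℝ} (hr : 0 < r)
    (c : ℝ) : energy α (fun x => (c * r) • g (r • x)) = c ^ 2 * r ^ 2 * (r ^ d)⁻¹ * energy α g := by
  unfold energy
  simp_rw [energyDensity_smul, integral_const_mul]
  rw [integral_comp_smul_pos hr (fun x => energyDensity α (g x))]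
  ring

theorem volume_ne_zero_comp_smul (φ : Space d → Space d) {r : ℝ} (hr : 0 < r) {c : ℝ}
    (hc : c ≠ 0) :
    volume {x | c • φ (r • x) ≠ 0} = ENNReal.ofReal ((r ^ d)⁻¹) * volume {x | φ x ≠ 0} := by
  have h := Measure.addHaar_preimage_smul (volume : Measure (Space d)) hr.ne' {x | φ x ≠ 0}
  rw [finrank_euclideanSpace_fin, abs_of_pos (by positivity)] at h
  rw [← h]
  congr 1
  ext x
  simp [hc]

/-- A field of `H¹` that does not vanish almost everywhere has positive norm. -/
theorem normSq_pos {φ : Space d → Space d} (hφ : MemLp φ 2 volume)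
    (h : volume {x | φ x ≠ 0} ≠ 0) : 0 < normSq φ := by
  have hi := (memLp_two_iff_integrable_sq_norm hφ.1).1 hφ
  refine (integral_pos_iff_support_of_nonneg (fun x => by positivity) hi).2 ?_
  have : Function.support (fun x => ‖φ x‖ ^ 2) = {x | φ x ≠ 0} := by
    ext x
    simp
  rw [this]
  exact pos_iff_ne_zero.2 h

theorem C_nonneg {α : ℝ} (hα : 0 < α) : 0 ≤ C d α := by
  refine Real.sInf_nonneg ?_
  rintro _ ⟨φ, g, -, -, rfl⟩
  exact mul_nonneg (inv_nonneg.2 (normSq_nonneg φ)) (energy_nonneg hα g)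

theorem C_le {α : ℝ} (hα : 0 < α) {φ : Space d → Space d} {g : Space d → Space d →L[ℝ] Space d}
    (h : HasH1Gradient φ g) (h1 : volume {x | φ x ≠ 0} = 1) :
    C d α ≤ (normSq φ)⁻¹ * energy α g := by
  refine csInf_le ⟨0, ?_⟩ ⟨φ, g, h, h1, rfl⟩
  rintro _ ⟨φ, g, -, -, rfl⟩
  exact mul_nonneg (inv_nonneg.2 (normSq_nonneg φ)) (energy_nonneg hα g)

/-- Rescaling turns a field with support of measure `m ∈ (0, ∞)` into one with support of
measure one. -/
theorem exists_volume_eq_one (hd : 1 ≤ d) {φ : Space d → Space d} (h0 : volume {x | φ x ≠ 0} ≠ 0)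
    (hT : volume {x | φ x ≠ 0} ≠ ⊤) :
    volume {x | (1 : ℝ) • φ (((volume {x | φ x ≠ 0}).toReal ^ (1 / d : ℝ)) • x) ≠ 0} = 1 := by
  set m := (volume {x | φ x ≠ 0}).toReal with hm
  have hm0 : 0 < m := ENNReal.toReal_pos h0 hT
  have hv : volume {x | φ x ≠ 0} = ENNReal.ofReal m := (ENNReal.ofReal_toReal hT).symm
  rw [volume_ne_zero_comp_smul φ (by positivity) one_ne_zero, hv,
    ← ENNReal.ofReal_mul (by positivity), one_div, Real.rpow_inv_natCast_pow hm0.le (by omega),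
    inv_mul_cancel₀ hm0.ne', ENNReal.ofReal_one]

/-- The scaling form of the definition of `𝒞_α`: it bounds the energy from below for every field
with support of measure at most `m`. -/
theorem C_mul_normSq_le_energy (hd : 1 ≤ d) {α : ℝ} (hα : 0 < α) {φ : Space d → Space d}
    {g : Space d → Space d →L[ℝ] Space d} (h : HasH1Gradient φ g) {m : ℝ} (hm : 0 < m)
    (hφ : volume {x | φ x ≠ 0} ≤ ENNReal.ofReal m) :
    (1 / m) ^ (2 / d : ℝ) * C d α * normSq φ ≤ energy α g := by
  by_cases h0 : volume {x | φ x ≠ 0} = 0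
  · have : normSq φ = 0 := by
      have hae : (fun x => ‖φ x‖ ^ 2) =ᵐ[volume] 0 := by
        have : ∀ᵐ x, ¬ (φ x ≠ 0) := by simpa [ae_iff] using h0
        filter_upwards [this] with x hx
        simpa using hx
      unfold normSq
      rw [integral_congr_ae hae]
      simp
    rw [this, mul_zero]
    exact energy_nonneg hα g
  have hT : volume {x | φ x ≠ 0} ≠ ⊤ := (hφ.trans_lt ENNReal.ofReal_lt_top).ne
  have h1 := exists_volume_eq_one hd h0 hT
  have hN := normSq_pos h.memLp h0
  set k := (volume {x | φ x ≠ 0}).toReal with hk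
  have hk0 : 0 < k := ENNReal.toReal_pos h0 hT
  have hkm : k ≤ m := ENNReal.toReal_le_of_le_ofReal hm.le hφ
  have hr : 0 < k ^ (1 / d : ℝ) := by positivity
  have hC := C_le hα (h.comp_smul hr 1) h1
  rw [normSq_comp_smul φ hr, energy_comp_smul α g hr] at hC
  have hr2 : (k ^ (1 / d : ℝ)) ^ 2 = k ^ (2 / d : ℝ) := by
    rw [← Real.rpow_natCast, ← Real.rpow_mul hk0.le]
    congr 1
    push_cast
    ring
  have hC' : C d α * normSq φ ≤ k ^ (2 / d : ℝ) * energy α g := by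
    rw [hr2] at hC
    have hrd : 0 < (k ^ (1 / d : ℝ)) ^ d := by positivity
    have e : (1 ^ 2 * ((k ^ (1 / d : ℝ)) ^ d)⁻¹ * normSq φ)⁻¹
        * (1 ^ 2 * k ^ (2 / d : ℝ) * ((k ^ (1 / d : ℝ)) ^ d)⁻¹ * energy α g)
        = k ^ (2 / d : ℝ) * energy α g / normSq φ := by
      field_simp
    rw [e] at hC
    exact (le_div_iff₀ hN).1 hC
  have hCm : C d α * normSq φ ≤ m ^ (2 / d : ℝ) * energy α g :=
    hC'.trans (mul_le_mul_of_nonneg_right (Real.rpow_le_rpow hk0.le hkm (by positivity))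
      (energy_nonneg hα g))
  have hmp : 0 < m ^ (2 / d : ℝ) := by positivity
  rw [Real.div_rpow zero_le_one hm.le, Real.one_rpow, mul_assoc, one_div_mul_eq_div,
    div_le_iff₀ hmp]
  linarith

theorem eLpNorm_sub_self {X E : Type*} [MeasurableSpace X] [NormedAddCommGroup E] (μ : Measure X)
    (f : X → E) : eLpNorm (fun x => f x - f x) 2 μ = 0 := by
  simp

theorem hasH1Gradient_of_contDiff {φ : Space d → Space d} (h : ContDiff ℝ ∞ φ)
    (hc : HasCompactSupport φ) : HasH1Gradient φ (fderiv ℝ φ) where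
  memLp := h.continuous.memLp_of_hasCompactSupport hc
  memLp_grad := (h.continuous_fderiv (by simp)).memLp_of_hasCompactSupport (hc.fderiv ℝ)
  mem_closure := ⟨fun _ => φ, fun _ => ⟨h, hc⟩,
    tendsto_const_nhds.congr fun _ => (eLpNorm_sub_self volume φ).symm,
    tendsto_const_nhds.congr fun _ => (eLpNorm_sub_self volume (fderiv ℝ φ)).symm⟩

/-- A rescaled bump function is admissible in the definition of `𝒞_α`. -/
theorem exists_hasH1Gradient_volume_eq_one (hd : 1 ≤ d) :
    ∃ (φ : Space d → Space d) (g : Space d → Space d →L[ℝ] Space d),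
      HasH1Gradient φ g ∧ volume {x | φ x ≠ 0} = 1 := by
  let b : ContDiffBump (0 : Space d) := ⟨1, 2, one_pos, one_lt_two⟩
  let e : Space d := EuclideanSpace.single ⟨0, hd⟩ 1
  have he : e ≠ 0 := by
    intro h
    have := congrArg norm h
    simp [e] at this
  have hs : {x | b x • e ≠ 0} = Metric.ball 0 2 := by
    rw [← b.support_eq]
    ext x
    simp [he]
  have h := hasH1Gradient_of_contDiff (φ := fun x => b x • e) (b.contDiff.smul contDiff_const)
    b.hasCompactSupport.smul_right
  have h0 : volume {x | b x • e ≠ 0} ≠ 0 := by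
    rw [hs]
    exact (Metric.measure_ball_pos _ _ two_pos).ne'
  have hT : volume {x | b x • e ≠ 0} ≠ ⊤ := by
    rw [hs]
    exact measure_ball_lt_top.ne
  have hpos : 0 < (volume {x | b x • e ≠ 0}).toReal := ENNReal.toReal_pos h0 hT
  exact ⟨_, _, h.comp_smul (by positivity) 1, exists_volume_eq_one hd h0 hT⟩

end Scaling

/-! ### The chain rule in `H¹` -/

section ChainRule

/-- Dominated convergence in `L²`. -/
theorem tendsto_eLpNorm_two_of_dominated {X E : Type*} [MeasurableSpace X] {μ : Measure X}
    [NormedAddCommGroup E] {F : ℕ → X → E} {b : X → ℝ} (hF : ∀ n, AEStronglyMeasurable (F n) μ)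
    (hb : MemLp b 2 μ) (hFb : ∀ n x, ‖F n x‖ ≤ b x)
    (hlim : ∀ᵐ x ∂μ, Tendsto (fun n => F n x) atTop (𝓝 0)) :
    Tendsto (fun n => eLpNorm (F n) 2 μ) atTop (𝓝 0) := by
  have hl : Tendsto (fun n => ∫⁻ x, ‖F n x‖ₑ ^ (2 : ℝ) ∂μ) atTop (𝓝 (∫⁻ _, 0 ∂μ)) := by
    refine tendsto_lintegral_of_dominated_convergence' (fun x => ‖b x‖ₑ ^ (2 : ℝ))
      (fun n => (hF n).enorm.pow_const _) (fun n => Eventually.of_forall fun x => ?_) ?_ ?_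
    · have : ‖F n x‖ₑ ≤ ‖b x‖ₑ :=
        enorm_le_iff_norm_le.2 ((hFb n x).trans (le_abs_self _))
      exact ENNReal.rpow_le_rpow this (by norm_num)
    · have := lintegral_rpow_enorm_lt_top_of_eLpNorm_lt_top two_ne_zero ENNReal.ofNat_ne_top hb.2
      simpa using this.ne
    · filter_upwards [hlim] with x hx
      have h1 : Tendsto (fun n => ‖F n x‖ₑ) atTop (𝓝 0) := by simpa using hx.enorm
      have h2 := h1.ennrpow_const 2
      simpa using h2
  rw [lintegral_zero] at hl
  have h3 := hl.ennrpow_const (1 / 2)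
  simpa [eLpNorm_eq_lintegral_rpow_enorm_toReal two_ne_zero ENNReal.ofNat_ne_top] using h3

/-- The chain rule in `H¹`: composition with a smooth map fixing the origin, with bounded
derivative. -/
theorem HasH1Gradient.comp {d : ℕ} {φ : Space d → Space d} {g : Space d → Space d →L[ℝ] Space d}
    (h : HasH1Gradient φ g) {T : Space d → Space d} (hT : ContDiff ℝ ∞ T) (hT0 : T 0 = 0)
    {K : ℝ} (hK : ∀ v, ‖fderiv ℝ T v‖ ≤ K) :
    HasH1Gradient (fun x => T (φ x)) (fun x => (fderiv ℝ T (φ x)).comp (g x)) := by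
  have hK0 : 0 ≤ K := (norm_nonneg _).trans (hK 0)
  have hdiff : Differentiable ℝ T := hT.differentiable (by simp)
  have hlip (v w : Space d) : ‖T v - T w‖ ≤ K * ‖v - w‖ :=
    convex_univ.norm_image_sub_le_of_norm_fderiv_le (fun x _ => hdiff x) (fun x _ => hK x)
      (Set.mem_univ w) (Set.mem_univ v)
  have hcd : Continuous (fderiv ℝ T) := hT.continuous_fderiv (by simp)
  have hφm := h.memLp.1
  have hgm := h.memLp_grad.1
  have hcomp : Continuous fun q : (Space d →L[ℝ] Space d) × (Space d →L[ℝ] Space d) =>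
      q.1.comp q.2 := by fun_prop
  have hcompm {A B : Space d → Space d →L[ℝ] Space d} (hA : AEStronglyMeasurable A volume)
      (hB : AEStronglyMeasurable B volume) :
      AEStronglyMeasurable (fun x => (A x).comp (B x)) volume :=
    hcomp.comp_aestronglyMeasurable (hA.prodMk hB)
  refine ⟨?_, ?_, ?_⟩
  · refine MemLp.of_le_mul (c := K) h.memLp (hT.continuous.comp_aestronglyMeasurable hφm)
      (Eventually.of_forall fun x => ?_)
    simpa [hT0] using hlip (φ x) 0
  · refine MemLp.of_le_mul (c := K) h.memLp_grad
      (hcompm (hcd.comp_aestronglyMeasurable hφm) hgm) (Eventually.of_forall fun x => ?_)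
    exact (ContinuousLinearMap.opNorm_comp_le _ _).trans
      (mul_le_mul_of_nonneg_right (hK _) (norm_nonneg _))
  obtain ⟨u, hu, hφ, hg⟩ := h.mem_closure
  have hum (n : ℕ) : AEStronglyMeasurable (u n) volume :=
    (hu n).1.continuous.aestronglyMeasurable
  have hdum (n : ℕ) : AEStronglyMeasurable (fderiv ℝ (u n)) volume :=
    ((hu n).1.continuous_fderiv (by simp)).aestronglyMeasurable
  -- The derivative of `T` along `u n` is only controlled almost everywhere, on a subsequence.
  obtain ⟨s, hs, hae⟩ := (tendstoInMeasure_of_tendsto_eLpNorm (p := 2) two_ne_zero hum hφm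
    hφ).exists_seq_tendsto_ae
  refine ⟨fun n x => T (u (s n) x), fun n => ⟨hT.comp (hu _).1, (hu _).2.comp_left hT0⟩, ?_, ?_⟩
  · have hb : Tendsto (fun n => ENNReal.ofReal K
        * eLpNorm (fun x => u (s n) x - φ x) 2 volume) atTop (𝓝 0) := by
      simpa using ENNReal.Tendsto.const_mul (hφ.comp hs.tendsto_atTop)
        (Or.inr ENNReal.ofReal_ne_top)
    exact tendsto_of_tendsto_of_tendsto_of_le_of_le tendsto_const_nhds hb (fun _ => zero_le)
      fun n => eLpNorm_le_mul_eLpNorm_of_ae_le_mul (Eventually.of_forall fun x => hlip _ _) 2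
  · have hb1 : Tendsto (fun n => ENNReal.ofReal K
        * eLpNorm (fun x => fderiv ℝ (u (s n)) x - g x) 2 volume) atTop (𝓝 0) := by
      simpa using ENNReal.Tendsto.const_mul (hg.comp hs.tendsto_atTop)
        (Or.inr ENNReal.ofReal_ne_top)
    have hb2 : Tendsto (fun n => eLpNorm (fun x =>
        (fderiv ℝ T (u (s n) x) - fderiv ℝ T (φ x)).comp (g x)) 2 volume) atTop (𝓝 0) := by
      refine tendsto_eLpNorm_two_of_dominated (b := fun x => (2 * K) * ‖g x‖) (fun n => ?_)
        (h.memLp_grad.norm.const_mul _) (fun n x => ?_) ?_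
      · exact hcompm ((hcd.comp_aestronglyMeasurable (hum _)).sub
          (hcd.comp_aestronglyMeasurable hφm)) hgm
      · refine (ContinuousLinearMap.opNorm_comp_le _ _).trans
          (mul_le_mul_of_nonneg_right ?_ (norm_nonneg _))
        exact (norm_sub_le _ _).trans (by linarith [hK (u (s n) x), hK (φ x)])
      · filter_upwards [hae] with x hx
        have h1 : Tendsto (fun n => fderiv ℝ T (u (s n) x) - fderiv ℝ T (φ x)) atTop (𝓝 0) := by
          simpa using ((hcd.tendsto _).comp hx).sub_const (fderiv ℝ T (φ x))
        have h2 := (hcomp.tendsto (0, g x)).comp (h1.prodMk_nhds tendsto_const_nhds)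
        simpa [Function.comp_def] using h2
    refine tendsto_of_tendsto_of_tendsto_of_le_of_le tendsto_const_nhds
      (by simpa using hb1.add hb2) (fun _ => zero_le) fun n => ?_
    have hsplit : (fun x => fderiv ℝ (fun x => T (u (s n) x)) x - (fderiv ℝ T (φ x)).comp (g x))
        = (fun x => (fderiv ℝ T (u (s n) x)).comp (fderiv ℝ (u (s n)) x - g x))
          + fun x => (fderiv ℝ T (u (s n) x) - fderiv ℝ T (φ x)).comp (g x) := by
      funext x
      have hux : DifferentiableAt ℝ (u (s n)) x := ((hu (s n)).1.differentiable (by simp)) x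
      rw [fderiv_fun_comp x (hdiff _) hux]
      ext v
      simp
    have hTu := hcd.comp_aestronglyMeasurable (hum (s n))
    rw [hsplit]
    refine (eLpNorm_add_le (hcompm hTu ((hdum (s n)).sub hgm))
      (hcompm (hTu.sub (hcd.comp_aestronglyMeasurable hφm)) hgm) one_le_two).trans ?_
    refine add_le_add_left ?_ _
    exact eLpNorm_le_mul_eLpNorm_of_ae_le_mul (Eventually.of_forall fun x =>
      (ContinuousLinearMap.opNorm_comp_le _ _).trans
        (mul_le_mul_of_nonneg_right (hK _) (norm_nonneg _))) 2

end ChainRule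

/-! ### The logarithmic cutoff -/

section Cutoff

variable {d : ℕ}

theorem exists_deriv_smoothTransition_bound :
    ∃ L > 0, ∀ x, |deriv Real.smoothTransition x| ≤ L := by
  have hc : Continuous (deriv Real.smoothTransition) :=
    (Real.smoothTransition.contDiff (n := 1)).continuous_deriv le_rfl
  obtain ⟨L, hL⟩ := (isCompact_Icc (a := (0 : ℝ)) (b := 1)).exists_bound_of_continuousOn
    hc.continuousOn
  refine ⟨|L| + 1, by positivity, fun x => ?_⟩
  by_cases hx : x ∈ Set.Icc (0 : ℝ) 1
  · exact (hL x hx).trans ((le_abs_self L).trans (by linarith))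
  · have h0 : deriv Real.smoothTransition x = 0 := by
      rw [Set.mem_Icc, not_and_or, not_le, not_le] at hx
      rcases hx with hx | hx
      · have : Real.smoothTransition =ᶠ[𝓝 x] fun _ => 0 := by
          filter_upwards [gt_mem_nhds hx] with y hy
          exact Real.smoothTransition.zero_of_nonpos (le_of_lt hy)
        simp [this.deriv_eq]
      · have : Real.smoothTransition =ᶠ[𝓝 x] fun _ => 1 := by
          filter_upwards [lt_mem_nhds hx] with y hy
          exact Real.smoothTransition.one_of_one_le (le_of_lt hy)
        simp [this.deriv_eq]
    rw [h0, abs_zero]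
    positivity

/-- The factor of the logarithmic cutoff: it vanishes for `‖v‖² ≤ a`, equals one for
`‖v‖² ≥ 2 a exp (1 / κ)`, and in between depends smoothly on `κ log ‖v‖²`, up to an additive
regularisation of `‖v‖²` which keeps the logarithm smooth at the origin. -/
noncomputable def cutoffFactor (a κ : ℝ) (v : Space d) : ℝ :=
  Real.smoothTransition (κ * Real.log ((‖v‖ ^ 2 + a) / (2 * a)))

/-- The logarithmic cutoff of vectors of small norm. -/
noncomputable def cutoff (a κ : ℝ) (v : Space d) : Space d := cutoffFactor a κ v • v

theorem cutoffFactor_nonneg (a κ : ℝ) (v : Space d) : 0 ≤ cutoffFactor a κ v :=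
  Real.smoothTransition.nonneg _

theorem cutoffFactor_le_one (a κ : ℝ) (v : Space d) : cutoffFactor a κ v ≤ 1 :=
  Real.smoothTransition.le_one _

theorem cutoff_zero (a κ : ℝ) : cutoff a κ (0 : Space d) = 0 := smul_zero _

theorem lt_norm_sq_of_cutoff_ne_zero {a κ : ℝ} (ha : 0 < a) (hκ : 0 < κ) {v : Space d}
    (h : cutoff a κ v ≠ 0) : a < ‖v‖ ^ 2 := by
  by_contra! hv
  refine h ?_
  have : cutoffFactor a κ v = 0 := by
    refine Real.smoothTransition.zero_of_nonpos (mul_nonpos_of_nonneg_of_nonpos hκ.le ?_)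
    refine Real.log_nonpos (by positivity) ?_
    rw [div_le_one (by positivity)]
    linarith
  simp [cutoff, this]

theorem cutoff_eq_self {a κ : ℝ} (ha : 0 < a) (hκ : 0 < κ) {v : Space d}
    (h : 2 * a * Real.exp (1 / κ) ≤ ‖v‖ ^ 2) : cutoff a κ v = v := by
  have : cutoffFactor a κ v = 1 := by
    refine Real.smoothTransition.one_of_one_le ?_
    have : 1 / κ ≤ Real.log ((‖v‖ ^ 2 + a) / (2 * a)) := by
      rw [Real.le_log_iff_exp_le (by positivity), le_div_iff₀ (by positivity)]
      linarith
    rw [div_le_iff₀ hκ] at this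
    linarith
  simp [cutoff, this]

theorem contDiff_cutoff {a κ : ℝ} (ha : 0 < a) : ContDiff ℝ ∞ (cutoff (d := d) a κ) := by
  have h1 : ContDiff ℝ ∞ fun v : Space d => (‖v‖ ^ 2 + a) / (2 * a) :=
    ((contDiff_norm_sq ℝ).add contDiff_const).div_const _
  have h2 : ContDiff ℝ ∞ fun v : Space d => Real.log ((‖v‖ ^ 2 + a) / (2 * a)) :=
    h1.log fun v => by positivity
  exact (Real.smoothTransition.contDiff.comp (contDiff_const.mul h2)).smul contDiff_id

/-- The derivative of the cutoff is a multiple of the identity plus a rank-one term, which is small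
with `κ`. -/
theorem exists_fderiv_cutoff_apply {a κ L : ℝ} (ha : 0 < a) (hκ : 0 < κ)
    (hL : ∀ x, |deriv Real.smoothTransition x| ≤ L) (v : Space d) :
    ∃ σ : ℝ, |σ| * ‖v‖ ^ 2 ≤ 2 * L * κ ∧ ∀ w, fderiv ℝ (cutoff a κ) v w
      = cutoffFactor a κ v • w + (σ * inner ℝ v w) • v := by
  set s := κ * Real.log ((‖v‖ ^ 2 + a) / (2 * a)) with hs
  have hL0 : 0 ≤ L := (abs_nonneg _).trans (hL 0)
  have hp : 0 < ‖v‖ ^ 2 + a := by positivity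
  refine ⟨deriv Real.smoothTransition s * (κ / (‖v‖ ^ 2 + a)) * 2, ?_, fun w => ?_⟩
  · rw [abs_mul, abs_mul, abs_two, abs_of_pos (div_pos hκ hp)]
    have h1 : κ / (‖v‖ ^ 2 + a) * ‖v‖ ^ 2 ≤ κ := by
      rw [div_mul_eq_mul_div, div_le_iff₀ hp]
      nlinarith
    have h0 : 0 ≤ κ / (‖v‖ ^ 2 + a) * ‖v‖ ^ 2 := by positivity
    calc |deriv Real.smoothTransition s| * (κ / (‖v‖ ^ 2 + a)) * 2 * ‖v‖ ^ 2
        = 2 * (|deriv Real.smoothTransition s| * (κ / (‖v‖ ^ 2 + a) * ‖v‖ ^ 2)) := by ring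
      _ ≤ 2 * (L * κ) := by
          gcongr
          exact hL s
      _ = 2 * L * κ := by ring
  · have hn : HasFDerivAt (fun v : Space d => ‖v‖ ^ 2) (2 • innerSL ℝ v) v :=
      (hasStrictFDerivAt_norm_sq v).hasFDerivAt
    have hF : HasDerivAt (fun ρ : ℝ => κ * Real.log ((ρ + a) / (2 * a)))
        (κ / (‖v‖ ^ 2 + a)) (‖v‖ ^ 2) := by
      have h1 : HasDerivAt (fun ρ : ℝ => (ρ + a) / (2 * a)) (1 / (2 * a)) (‖v‖ ^ 2) :=
        ((hasDerivAt_id _).add_const a).div_const _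
      have h2 : (‖v‖ ^ 2 + a) / (2 * a) ≠ 0 := by positivity
      have e : κ / (‖v‖ ^ 2 + a) = κ * (1 / (2 * a) / ((‖v‖ ^ 2 + a) / (2 * a))) := by
        have := hp.ne'
        field_simp
      rw [e]
      exact (h1.log h2).const_mul κ
    have hS : HasDerivAt Real.smoothTransition (deriv Real.smoothTransition s) s :=
      ((Real.smoothTransition.contDiff (n := 1)).differentiable (by simp) s).hasDerivAt
    have hχ := (hS.comp_of_eq _ hF rfl).comp_hasFDerivAt v hn
    have hc := hχ.smul (hasFDerivAt_id v)
    have e : fderiv ℝ (cutoff a κ) v = _ := HasFDerivAt.fderiv hc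
    rw [e]
    simp [cutoffFactor, ← hs, mul_assoc]

theorem norm_fderiv_cutoff_le {a κ L : ℝ} (ha : 0 < a) (hκ : 0 < κ)
    (hL : ∀ x, |deriv Real.smoothTransition x| ≤ L) (v : Space d) :
    ‖fderiv ℝ (cutoff a κ) v‖ ≤ 1 + 2 * L * κ := by
  obtain ⟨σ, hσ, h⟩ := exists_fderiv_cutoff_apply ha hκ hL v
  have hL0 : 0 ≤ L := (abs_nonneg _).trans (hL 0)
  refine ContinuousLinearMap.opNorm_le_bound _ (by positivity) fun w => ?_
  rw [h w]
  calc ‖cutoffFactor a κ v • w + (σ * inner ℝ v w) • v‖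
      ≤ |cutoffFactor a κ v| * ‖w‖ + |σ| * |inner ℝ v w| * ‖v‖ := by
        refine (norm_add_le _ _).trans_eq ?_
        rw [norm_smul, norm_smul, norm_mul, Real.norm_eq_abs, Real.norm_eq_abs, Real.norm_eq_abs]
    _ ≤ 1 * ‖w‖ + |σ| * (‖v‖ * ‖w‖) * ‖v‖ := by
        gcongr
        · rw [abs_of_nonneg (cutoffFactor_nonneg a κ v)]
          exact cutoffFactor_le_one a κ v
        · exact abs_real_inner_le_norm v w
    _ = ‖w‖ + |σ| * ‖v‖ ^ 2 * ‖w‖ := by ring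
    _ ≤ ‖w‖ + 2 * L * κ * ‖w‖ := by gcongr
    _ = (1 + 2 * L * κ) * ‖w‖ := by ring

theorem sum_entry_sq (A : Space d →L[ℝ] Space d) (j : Fin d) :
    ∑ k, entry A j k ^ 2 = ‖A (EuclideanSpace.single j 1)‖ ^ 2 :=
  (EuclideanSpace.real_norm_sq_eq _).symm

/-- A contraction of the form `t • 1` with a small rank-one perturbation nearly decreases the
energy density. -/
theorem energyDensity_comp_le {α η t σ : ℝ} (hα : 0 < α) (hη : 0 < η) (ht0 : 0 ≤ t) (ht1 : t ≤ 1)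
    {v : Space d} (hσ : |σ| * ‖v‖ ^ 2 ≤ η) {M : Space d →L[ℝ] Space d}
    (hM : ∀ w, M w = t • w + (σ * inner ℝ v w) • v) (A : Space d →L[ℝ] Space d) :
    energyDensity α (M.comp A)
      ≤ (1 + η + (η + η ^ 2) * (1 + d / α)) * energyDensity α A := by
  set b : Fin d → Fin d → ℝ :=
    fun j k => σ * inner ℝ v (A (EuclideanSpace.single j 1)) * v k with hb
  have he (j k : Fin d) : entry (M.comp A) j k = t * entry A j k + b j k := by
    simp [entry, hM, hb]
  -- Young's inequality with weight `η`.
  have hsq (x y : ℝ) : (t * x + y) ^ 2 ≤ (1 + η) * x ^ 2 + (1 + 1 / η) * y ^ 2 := by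
    have h1 : (t * x) ^ 2 ≤ x ^ 2 := by
      rw [mul_pow]
      exact mul_le_of_le_one_left (sq_nonneg x) (pow_le_one₀ ht0 ht1)
    have h2 : 2 * (t * x) * y ≤ η * (t * x) ^ 2 + 1 / η * y ^ 2 := by
      have : η * (t * x) ^ 2 + 1 / η * y ^ 2 - 2 * (t * x) * y
          = (η * (t * x) - y) ^ 2 / η := by
        field_simp
        ring
      have : 0 ≤ (η * (t * x) - y) ^ 2 / η := by positivity
      linarith
    nlinarith
  set SA := ∑ j, ∑ k, entry A j k ^ 2 with hSA
  set SB := ∑ j, ∑ k, b j k ^ 2 with hSB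
  have hSA0 : 0 ≤ SA := by positivity
  have hB : SB ≤ η ^ 2 * SA := by
    rw [hSB, hSA, Finset.mul_sum]
    refine Finset.sum_le_sum fun j _ => ?_
    rw [sum_entry_sq]
    simp only [hb, mul_pow _ (v _), ← Finset.mul_sum]
    rw [← EuclideanSpace.real_norm_sq_eq]
    have h1 : |inner ℝ v (A (EuclideanSpace.single j 1))|
        ≤ ‖v‖ * ‖A (EuclideanSpace.single j 1)‖ := abs_real_inner_le_norm _ _
    calc (σ * inner ℝ v (A (EuclideanSpace.single j 1))) ^ 2 * ‖v‖ ^ 2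
        = |σ| ^ 2 * |inner ℝ v (A (EuclideanSpace.single j 1))| ^ 2 * ‖v‖ ^ 2 := by
          rw [sq_abs, sq_abs, mul_pow]
      _ ≤ |σ| ^ 2 * (‖v‖ * ‖A (EuclideanSpace.single j 1)‖) ^ 2 * ‖v‖ ^ 2 := by gcongr
      _ = (|σ| * ‖v‖ ^ 2) ^ 2 * ‖A (EuclideanSpace.single j 1)‖ ^ 2 := by ring
      _ ≤ η ^ 2 * ‖A (EuclideanSpace.single j 1)‖ ^ 2 := by gcongr
  have hD : (∑ j, b j j) ^ 2 ≤ d * SB := by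
    refine sq_sum_le_card_mul_sum_sq.trans ?_
    rw [Finset.card_univ, Fintype.card_fin]
    refine mul_le_mul_of_nonneg_left (Finset.sum_le_sum fun j _ => ?_) (Nat.cast_nonneg d)
    exact Finset.single_le_sum (f := fun k => b j k ^ 2) (fun _ _ => sq_nonneg _)
      (Finset.mem_univ j)
  have h1 : ∑ j, ∑ k, (t * entry A j k + b j k) ^ 2 ≤ (1 + η) * SA + (1 + 1 / η) * SB := by
    simp only [hSA, hSB, Finset.mul_sum, ← Finset.sum_add_distrib]
    exact Finset.sum_le_sum fun j _ => Finset.sum_le_sum fun k _ => hsq _ _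
  have h2 : (∑ j, (t * entry A j j + b j j)) ^ 2
      ≤ (1 + η) * (∑ j, entry A j j) ^ 2 + (1 + 1 / η) * (∑ j, b j j) ^ 2 := by
    rw [Finset.sum_add_distrib, ← Finset.mul_sum]
    exact hsq _ _
  have hη1 : 0 ≤ 1 + 1 / η := by positivity
  have hα1 : 0 ≤ α⁻¹ := by positivity
  have h3 : SB + α⁻¹ * (∑ j, b j j) ^ 2 ≤ (1 + d / α) * (η ^ 2 * SA) := by
    calc SB + α⁻¹ * (∑ j, b j j) ^ 2 ≤ SB + α⁻¹ * (d * SB) := by gcongr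
      _ = (1 + d / α) * SB := by ring
      _ ≤ (1 + d / α) * (η ^ 2 * SA) := by gcongr
  have h4 : SA ≤ energyDensity α A := by
    unfold energyDensity
    have : 0 ≤ α⁻¹ * (∑ j, entry A j j) ^ 2 := by positivity
    linarith
  have h5 : energyDensity α (M.comp A)
      ≤ (1 + η) * energyDensity α A + (1 + 1 / η) * (SB + α⁻¹ * (∑ j, b j j) ^ 2) := by
    simp only [energyDensity, he]
    have := mul_le_mul_of_nonneg_left h2 hα1
    rw [← hSA]
    linarith
  calc energyDensity α (M.comp A)
      ≤ (1 + η) * energyDensity α A + (1 + 1 / η) * ((1 + d / α) * (η ^ 2 * SA)) :=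
        h5.trans (by gcongr)
    _ = (1 + η) * energyDensity α A + (η + η ^ 2) * (1 + d / α) * SA := by
        field_simp
        ring
    _ ≤ (1 + η) * energyDensity α A + (η + η ^ 2) * (1 + d / α) * energyDensity α A := by
        gcongr
    _ = _ := by ring

theorem integrable_energyDensity {g : Space d → Space d →L[ℝ] Space d} (hg : MemLp g 2 volume)
    (α : ℝ) : Integrable (fun x => energyDensity α (g x)) := by
  have he (j k : Fin d) : MemLp (fun x => entry (g x) j k) 2 volume := by
    have hc : Continuous fun A : Space d →L[ℝ] Space d => entry A j k := by
      unfold entry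
      fun_prop
    refine MemLp.of_le hg (hc.comp_aestronglyMeasurable hg.1) (Eventually.of_forall fun x => ?_)
    refine (PiLp.norm_apply_le _ k).trans ((g x).le_opNorm _ |>.trans ?_)
    simp
  unfold energyDensity
  refine Integrable.add (integrable_finsetSum _ fun j _ => integrable_finsetSum _ fun k _ =>
    (he j k).integrable_sq) (Integrable.const_mul ?_ _)
  exact (memLp_finsetSum _ fun j _ => he j j).integrable_sq

/-- The logarithmic cutoff of a field of `H¹` belongs to `H¹` and its energy is at most
`1 + θ` times the original one; the divergence term makes a slowly varying cutoff necessary. -/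
theorem exists_cutoff_energy_le {α : ℝ} (hα : 0 < α) {θ : ℝ} (hθ : 0 < θ) :
    ∃ κ > 0, ∀ a > 0, ∀ (φ : Space d → Space d) (g : Space d → Space d →L[ℝ] Space d),
      HasH1Gradient φ g → ∃ g', HasH1Gradient (fun x => cutoff a κ (φ x)) g' ∧
        energy α g' ≤ (1 + θ) * energy α g := by
  obtain ⟨L, hL0, hL⟩ := exists_deriv_smoothTransition_bound
  have hlim : Tendsto (fun η : ℝ => η + (η + η ^ 2) * (1 + d / α)) (𝓝[>] 0) (𝓝 0) := by
    have : Continuous fun η : ℝ => η + (η + η ^ 2) * (1 + d / α) := by fun_prop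
    exact (this.tendsto' 0 0 (by simp)).mono_left nhdsWithin_le_nhds
  obtain ⟨η, hηθ, hη⟩ := ((hlim.eventually_lt_const hθ).and self_mem_nhdsWithin).exists
  have hη : 0 < η := hη
  refine ⟨η / (2 * L), by positivity, fun a ha φ g h => ?_⟩
  have hκ : 0 < η / (2 * L) := by positivity
  have hcomp := h.comp (contDiff_cutoff (κ := η / (2 * L)) ha) (cutoff_zero _ _)
    (norm_fderiv_cutoff_le ha hκ hL)
  refine ⟨_, hcomp, ?_⟩
  unfold energy
  rw [← integral_const_mul]
  refine integral_mono (integrable_energyDensity hcomp.memLp_grad α)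
    ((integrable_energyDensity h.memLp_grad α).const_mul _) fun x => ?_
  obtain ⟨σ, hσ, hM⟩ := exists_fderiv_cutoff_apply ha hκ hL (φ x)
  have hσ' : |σ| * ‖φ x‖ ^ 2 ≤ η := hσ.trans_eq (by field_simp)
  refine (energyDensity_comp_le hα hη (cutoffFactor_nonneg _ _ _) (cutoffFactor_le_one _ _ _)
    hσ' hM (g x)).trans ?_
  refine mul_le_mul_of_nonneg_right ?_ (energyDensity_nonneg hα _)
  linarith

end Cutoff

/-! ### The functions `G` and `Γ` -/

section LogLaplace

variable {Ω : Type*} [MeasurableSpace Ω] {P : Measure Ω} [IsProbabilityMeasure P] {ξ : Ω → ℝ}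

theorem integrable_exp_neg_mul (hξ : AEMeasurable ξ P) (hξ01 : ∀ᵐ w ∂P, 0 ≤ ξ w ∧ ξ w ≤ 1)
    {u : ℝ} (hu : 0 ≤ u) : Integrable (fun w => Real.exp (-u * ξ w)) P := by
  refine Integrable.of_bound (C := 1) (hξ.const_mul (-u)).exp.aestronglyMeasurable ?_
  filter_upwards [hξ01] with w hw
  rw [Real.norm_eq_abs, Real.abs_exp, Real.exp_le_one_iff]
  nlinarith [hw.1]

theorem integral_exp_neg_mul_le_one (hξ : AEMeasurable ξ P)
    (hξ01 : ∀ᵐ w ∂P, 0 ≤ ξ w ∧ ξ w ≤ 1) {u : ℝ} (hu : 0 ≤ u) :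
    ∫ w, Real.exp (-u * ξ w) ∂P ≤ 1 := by
  have h : ∫ w, Real.exp (-u * ξ w) ∂P ≤ ∫ _, (1 : ℝ) ∂P := by
    refine integral_mono_ae (integrable_exp_neg_mul hξ hξ01 hu) (integrable_const _) ?_
    filter_upwards [hξ01] with w hw
    rw [Real.exp_le_one_iff]
    nlinarith [hw.1]
  simpa using h

theorem exp_neg_le_integral_exp_neg_mul (hξ : AEMeasurable ξ P)
    (hξ01 : ∀ᵐ w ∂P, 0 ≤ ξ w ∧ ξ w ≤ 1) {u : ℝ} (hu : 0 ≤ u) :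
    Real.exp (-u) ≤ ∫ w, Real.exp (-u * ξ w) ∂P := by
  have h : ∫ _, Real.exp (-u) ∂P ≤ ∫ w, Real.exp (-u * ξ w) ∂P := by
    refine integral_mono_ae (integrable_const _) (integrable_exp_neg_mul hξ hξ01 hu) ?_
    filter_upwards [hξ01] with w hw
    rw [Real.exp_le_exp]
    nlinarith [hw.2]
  simpa using h

theorem integral_exp_neg_mul_pos (hξ : AEMeasurable ξ P)
    (hξ01 : ∀ᵐ w ∂P, 0 ≤ ξ w ∧ ξ w ≤ 1) {u : ℝ} (hu : 0 ≤ u) :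
    0 < ∫ w, Real.exp (-u * ξ w) ∂P :=
  (Real.exp_pos _).trans_le (exp_neg_le_integral_exp_neg_mul hξ hξ01 hu)

theorem G_nonneg (hξ : AEMeasurable ξ P) (hξ01 : ∀ᵐ w ∂P, 0 ≤ ξ w ∧ ξ w ≤ 1) {u : ℝ}
    (hu : 0 ≤ u) : 0 ≤ G P ξ u :=
  neg_nonneg.2 (Real.log_nonpos (integral_exp_neg_mul_pos hξ hξ01 hu).le
    (integral_exp_neg_mul_le_one hξ hξ01 hu))

theorem G_le_self (hξ : AEMeasurable ξ P) (hξ01 : ∀ᵐ w ∂P, 0 ≤ ξ w ∧ ξ w ≤ 1) {u : ℝ}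
    (hu : 0 ≤ u) : G P ξ u ≤ u := by
  have := (Real.le_log_iff_exp_le (integral_exp_neg_mul_pos hξ hξ01 hu)).2
    (exp_neg_le_integral_exp_neg_mul hξ hξ01 hu)
  unfold G
  linarith

theorem integral_exp_neg_mul_anti (hξ : AEMeasurable ξ P)
    (hξ01 : ∀ᵐ w ∂P, 0 ≤ ξ w ∧ ξ w ≤ 1) {u v : ℝ} (hu : 0 ≤ u) (huv : u ≤ v) :
    ∫ w, Real.exp (-v * ξ w) ∂P ≤ ∫ w, Real.exp (-u * ξ w) ∂P := by
  refine integral_mono_ae (integrable_exp_neg_mul hξ hξ01 (hu.trans huv))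
    (integrable_exp_neg_mul hξ hξ01 hu) ?_
  filter_upwards [hξ01] with w hw
  rw [Real.exp_le_exp]
  nlinarith [hw.1]

theorem G_mono (hξ : AEMeasurable ξ P) (hξ01 : ∀ᵐ w ∂P, 0 ≤ ξ w ∧ ξ w ≤ 1) {u v : ℝ}
    (hu : 0 ≤ u) (huv : u ≤ v) : G P ξ u ≤ G P ξ v :=
  neg_le_neg (Real.log_le_log (integral_exp_neg_mul_pos hξ hξ01 (hu.trans huv))
    (integral_exp_neg_mul_anti hξ hξ01 hu huv))

/-- `E exp(-u ξ)` decreases to `P{ξ = 0}`. -/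
theorem tendsto_integral_exp_neg_mul (hξ : AEMeasurable ξ P)
    (hξ01 : ∀ᵐ w ∂P, 0 ≤ ξ w ∧ ξ w ≤ 1) :
    Tendsto (fun u : ℝ => ∫ w, Real.exp (-u * ξ w) ∂P) atTop (𝓝 (P.real {w | ξ w = 0})) := by
  have hm : NullMeasurableSet {w | ξ w = 0} P :=
    hξ.nullMeasurableSet_preimage (measurableSet_singleton 0)
  have h1 : ∫ w, {w | ξ w = 0}.indicator (fun _ => (1 : ℝ)) w ∂P = P.real {w | ξ w = 0} := by
    rw [integral_indicator₀ hm]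
    simp
  rw [← h1]
  refine tendsto_integral_filter_of_dominated_convergence (fun _ => 1)
    (Eventually.of_forall fun u => (hξ.const_mul (-u)).exp.aestronglyMeasurable) ?_
    (integrable_const _) ?_
  · filter_upwards [eventually_ge_atTop (0 : ℝ)] with u hu
    filter_upwards [hξ01] with w hw
    rw [Real.norm_eq_abs, Real.abs_exp, Real.exp_le_one_iff]
    nlinarith [hw.1]
  · filter_upwards [hξ01] with w hw
    by_cases h0 : ξ w = 0
    · simp [h0]
    · have hpos : 0 < ξ w := lt_of_le_of_ne hw.1 (Ne.symm h0)
      simpa [h0] using tendsto_id.atTop_mul_const hpos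

theorem G_le_log_one_div (hξ : AEMeasurable ξ P) (hξ01 : ∀ᵐ w ∂P, 0 ≤ ξ w ∧ ξ w ≤ 1)
    {p : ℝ} (hp : 0 < p) (h : p ≤ P.real {w | ξ w = 0}) {u : ℝ} (hu : 0 ≤ u) :
    G P ξ u ≤ Real.log (1 / p) := by
  have h1 : P.real {w | ξ w = 0} ≤ ∫ w, Real.exp (-u * ξ w) ∂P := by
    refine le_of_tendsto (tendsto_integral_exp_neg_mul hξ hξ01) ?_
    filter_upwards [eventually_ge_atTop u] with v hv
    exact integral_exp_neg_mul_anti hξ hξ01 hu hv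
  rw [one_div, Real.log_inv]
  exact neg_le_neg (Real.log_le_log hp (h.trans h1))

theorem exists_le_G (hξ : AEMeasurable ξ P) (hξ01 : ∀ᵐ w ∂P, 0 ≤ ξ w ∧ ξ w ≤ 1)
    {p : ℝ} (hp : 0 < p) (h : P.real {w | ξ w = 0} ≤ p) {b : ℝ} (hb : b < Real.log (1 / p)) :
    ∃ u₀ > 0, ∀ u, u₀ ≤ u → b ≤ G P ξ u := by
  have h1 : P.real {w | ξ w = 0} < Real.exp (-b) := by
    refine h.trans_lt ?_
    rw [one_div, Real.log_inv] at hb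
    rw [← Real.log_lt_iff_lt_exp hp]
    linarith
  obtain ⟨u₀, hu, hu0⟩ := (((tendsto_integral_exp_neg_mul hξ hξ01).eventually_lt_const h1).and
    (eventually_gt_atTop 0)).exists
  refine ⟨u₀, hu0, fun u huu => le_trans ?_ (G_mono hξ hξ01 hu0.le huu)⟩
  have := (Real.log_le_iff_le_exp (integral_exp_neg_mul_pos hξ hξ01 hu0.le)).2 hu.le
  unfold G
  linarith

theorem mul_integral_div_two_le_G (hξ : AEMeasurable ξ P) (hξ01 : ∀ᵐ w ∂P, 0 ≤ ξ w ∧ ξ w ≤ 1)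
    {u : ℝ} (hu : 0 ≤ u) (hu1 : u ≤ 1) : u * ((∫ w, ξ w ∂P) / 2) ≤ G P ξ u := by
  have hi : Integrable ξ P := by
    refine Integrable.of_bound (C := 1) hξ.aestronglyMeasurable ?_
    filter_upwards [hξ01] with w hw
    rw [Real.norm_eq_abs, abs_of_nonneg hw.1]
    exact hw.2
  have h1 : ∫ w, Real.exp (-u * ξ w) ∂P ≤ ∫ w, (1 - u / 2 * ξ w) ∂P := by
    refine integral_mono_ae (integrable_exp_neg_mul hξ hξ01 hu)
      ((integrable_const _).sub (hi.const_mul _)) ?_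
    filter_upwards [hξ01] with w hw
    have hx0 : 0 ≤ u * ξ w := mul_nonneg hu hw.1
    have hx1 : u * ξ w ≤ 1 := mul_le_one₀ hu1 hw.1 hw.2
    -- `exp(-x) ≤ 1 - x/2` on `[0, 1]`, from `exp x ≥ 1 + x`.
    have he : Real.exp (-(u * ξ w)) ≤ (1 + u * ξ w)⁻¹ := by
      rw [Real.exp_neg]
      exact inv_anti₀ (by linarith) (by linarith [Real.add_one_le_exp (u * ξ w)])
    have h3 : (1 + u * ξ w)⁻¹ ≤ 1 - u / 2 * ξ w := by
      rw [inv_le_iff_one_le_mul₀ (by linarith)]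
      nlinarith
    simpa using he.trans h3
  rw [integral_sub (integrable_const _) (hi.const_mul _), integral_const_mul] at h1
  simp only [integral_const, probReal_univ, smul_eq_mul, mul_one] at h1
  have h2 := Real.log_le_sub_one_of_pos (integral_exp_neg_mul_pos hξ hξ01 hu)
  unfold G
  linarith

variable {d : ℕ} {φ : Space d → Space d}

theorem integrable_G (hξ : AEMeasurable ξ P) (hξ01 : ∀ᵐ w ∂P, 0 ≤ ξ w ∧ ξ w ≤ 1)
    (hφ : MemLp φ 2 volume) {h : ℝ} (hh : 0 ≤ h) :
    Integrable fun x => G P ξ (h * ‖φ x‖ ^ 2) := by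
  have hmono : Monotone fun u => G P ξ (max u 0) := fun u v huv =>
    G_mono hξ hξ01 (le_max_right _ _) (max_le_max_right 0 huv)
  have hm : AEStronglyMeasurable (fun x => G P ξ (h * ‖φ x‖ ^ 2)) := by
    have h1 : AEMeasurable (fun x => h * ‖φ x‖ ^ 2) :=
      ((hφ.1.norm.aemeasurable).pow_const 2).const_mul h
    have h2 := (hmono.measurable.comp_aemeasurable h1).aestronglyMeasurable
    refine h2.congr (Eventually.of_forall fun x => ?_)
    have : 0 ≤ h * ‖φ x‖ ^ 2 := by positivity
    simp [max_eq_left this]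
  refine Integrable.mono' (((memLp_two_iff_integrable_sq_norm hφ.1).1 hφ).const_mul h) hm
    (Eventually.of_forall fun x => ?_)
  have hx : 0 ≤ h * ‖φ x‖ ^ 2 := by positivity
  rw [Real.norm_eq_abs, abs_of_nonneg (G_nonneg hξ hξ01 hx)]
  exact G_le_self hξ hξ01 hx

theorem Gam_nonneg (hξ : AEMeasurable ξ P) (hξ01 : ∀ᵐ w ∂P, 0 ≤ ξ w ∧ ξ w ≤ 1) {h : ℝ}
    (hh : 0 ≤ h) : 0 ≤ Gam P ξ h φ :=
  integral_nonneg fun x => G_nonneg hξ hξ01 (by positivity)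

theorem Gam_le (hξ : AEMeasurable ξ P) (hξ01 : ∀ᵐ w ∂P, 0 ≤ ξ w ∧ ξ w ≤ 1)
    (hφ : MemLp φ 2 volume) {h : ℝ} (hh : 0 ≤ h) : Gam P ξ h φ ≤ h * normSq φ := by
  unfold Gam normSq
  rw [← integral_const_mul]
  exact integral_mono (integrable_G hξ hξ01 hφ hh)
    (((memLp_two_iff_integrable_sq_norm hφ.1).1 hφ).const_mul h)
    fun x => G_le_self hξ hξ01 (by positivity)

/-- Markov-type lower bound for `Γ`, from a lower bound for `G` on a part of the half-line. -/
theorem setIntegral_le_Gam (hξ : AEMeasurable ξ P) (hξ01 : ∀ᵐ w ∂P, 0 ≤ ξ w ∧ ξ w ≤ 1)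
    (hφ : MemLp φ 2 volume) {h : ℝ} (hh : 0 ≤ h) (s : Set (Space d))
    (hs : NullMeasurableSet s) {f : Space d → ℝ} (hf : IntegrableOn f s)
    (hfG : ∀ x ∈ s, f x ≤ G P ξ (h * ‖φ x‖ ^ 2)) : ∫ x in s, f x ≤ Gam P ξ h φ := by
  have hG := integrable_G hξ hξ01 hφ hh
  calc ∫ x in s, f x ≤ ∫ x in s, G P ξ (h * ‖φ x‖ ^ 2) :=
        setIntegral_mono_on₀ hf hG.integrableOn hs hfG
    _ ≤ Gam P ξ h φ := setIntegral_le_integral hG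
        (Eventually.of_forall fun x => G_nonneg hξ hξ01 (by positivity))

theorem bddAbove_calG (hξ : AEMeasurable ξ P) (hξ01 : ∀ᵐ w ∂P, 0 ≤ ξ w ∧ ξ w ≤ 1)
    (hφ : MemLp φ 2 volume) {D : ℝ} (hD : 0 ≤ D) :
    BddAbove (Set.range fun h : Set.Ioi (0 : ℝ) => (h : ℝ)⁻¹ * (Gam P ξ h φ - D)) := by
  refine ⟨normSq φ, ?_⟩
  rintro _ ⟨⟨h, hh⟩, rfl⟩
  have hh : 0 < h := hh
  have := Gam_le hξ hξ01 hφ hh.le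
  change h⁻¹ * (Gam P ξ h φ - D) ≤ normSq φ
  rw [inv_mul_le_iff₀ hh]
  linarith

theorem le_calG (hξ : AEMeasurable ξ P) (hξ01 : ∀ᵐ w ∂P, 0 ≤ ξ w ∧ ξ w ≤ 1)
    (hφ : MemLp φ 2 volume) {D : ℝ} (hD : 0 ≤ D) {h : ℝ} (hh : 0 < h) :
    h⁻¹ * (Gam P ξ h φ - D) ≤ calG P ξ φ D :=
  le_ciSup (bddAbove_calG hξ hξ01 hφ hD) ⟨h, hh⟩

theorem Gam_le_of_calG_le (hξ : AEMeasurable ξ P) (hξ01 : ∀ᵐ w ∂P, 0 ≤ ξ w ∧ ξ w ≤ 1)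
    (hφ : MemLp φ 2 volume) {D δ : ℝ} (hD : 0 ≤ D) (hδ : calG P ξ φ D ≤ δ) {h : ℝ} (hh : 0 < h) :
    Gam P ξ h φ ≤ D + h * δ := by
  have h1 := (le_calG hξ hξ01 hφ hD hh).trans hδ
  rw [inv_mul_le_iff₀ hh] at h1
  linarith

theorem calG_nonneg (hξ : AEMeasurable ξ P) (hξ01 : ∀ᵐ w ∂P, 0 ≤ ξ w ∧ ξ w ≤ 1)
    (hφ : MemLp φ 2 volume) {D : ℝ} (hD : 0 ≤ D) : 0 ≤ calG P ξ φ D := by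
  have hlim : Tendsto (fun h : ℝ => h⁻¹ * -D) atTop (𝓝 0) := by
    simpa using tendsto_inv_atTop_zero.mul_const (-D)
  refine le_of_tendsto hlim ?_
  filter_upwards [eventually_gt_atTop 0] with h hh
  refine le_trans ?_ (le_calG hξ hξ01 hφ hD hh)
  have := Gam_nonneg (φ := φ) hξ hξ01 hh.le
  exact mul_le_mul_of_nonneg_left (by linarith) (inv_nonneg.2 hh.le)

end LogLaplace

/-! ### Comparison of `𝒞_{α,β}` with `𝒞_α` -/

section Limit

variable {Ω : Type*} [MeasurableSpace Ω] {P : Measure Ω} [IsProbabilityMeasure P] {ξ : Ω → ℝ}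
  {d : ℕ}

theorem integrable_norm_sq {φ : Space d → Space d} (hφ : MemLp φ 2 volume) :
    Integrable fun x => ‖φ x‖ ^ 2 :=
  (memLp_two_iff_integrable_sq_norm hφ.1).1 hφ

theorem nullMeasurableSet_norm_sq_le {φ : Space d → Space d} (hφ : MemLp φ 2 volume) (b : ℝ) :
    NullMeasurableSet {x | ‖φ x‖ ^ 2 ≤ b} :=
  (hφ.1.norm.aemeasurable.pow_const 2).nullMeasurableSet_preimage measurableSet_Iic

/-- The linear lower bound for `G` near `0` shows that little mass sits where `φ` is small. -/
theorem setIntegral_norm_sq_le (hξ : AEMeasurable ξ P) (hξ01 : ∀ᵐ w ∂P, 0 ≤ ξ w ∧ ξ w ≤ 1)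
    (hμ : 0 < ∫ w, ξ w ∂P) {φ : Space d → Space d} (hφ : MemLp φ 2 volume) {D δ b : ℝ}
    (hD : 0 ≤ D) (hδ : calG P ξ φ D ≤ δ) (hb : 0 < b) :
    ∫ x in {x | ‖φ x‖ ^ 2 ≤ b}, ‖φ x‖ ^ 2 ≤ (b * D + δ) / ((∫ w, ξ w ∂P) / 2) := by
  set c := (∫ w, ξ w ∂P) / 2 with hc
  have hc0 : 0 < c := by positivity
  have h1 := setIntegral_le_Gam hξ hξ01 hφ (inv_nonneg.2 hb.le) {x | ‖φ x‖ ^ 2 ≤ b}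
    (nullMeasurableSet_norm_sq_le hφ b) (f := fun x => (b⁻¹ * c) * ‖φ x‖ ^ 2)
    ((integrable_norm_sq hφ).const_mul _).integrableOn fun x hx => by
      have hx : ‖φ x‖ ^ 2 ≤ b := hx
      refine le_of_eq_of_le (by ring) (mul_integral_div_two_le_G hξ hξ01
        (u := b⁻¹ * ‖φ x‖ ^ 2) (by positivity) ?_)
      rwa [inv_mul_le_iff₀ hb, mul_one]
  have h2 := h1.trans (Gam_le_of_calG_le hξ hξ01 hφ hD hδ (inv_pos.2 hb))
  rw [integral_const_mul, mul_assoc, inv_mul_le_iff₀ hb] at h2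
  have e : b * (D + b⁻¹ * δ) = b * D + δ := by
    field_simp
  rw [e] at h2
  rw [le_div_iff₀ hc0]
  linarith

/-- The behaviour of `G` at infinity bounds the measure of the set where `φ` is not small. -/
theorem measure_lt_norm_sq_le (hξ : AEMeasurable ξ P) (hξ01 : ∀ᵐ w ∂P, 0 ≤ ξ w ∧ ξ w ≤ 1)
    {φ : Space d → Space d} (hφ : MemLp φ 2 volume) {D δ a b u₀ : ℝ}
    (hD : 0 ≤ D) (hδ : calG P ξ φ D ≤ δ) (ha : 0 < a) (hb : 0 < b) (hu₀ : 0 < u₀)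
    (hG : ∀ u, u₀ ≤ u → b ≤ G P ξ u) :
    volume {x | a < ‖φ x‖ ^ 2} ≤ ENNReal.ofReal ((D + u₀ / a * δ) / b) := by
  have hh : 0 < u₀ / a := by positivity
  have hs : NullMeasurableSet {x | a < ‖φ x‖ ^ 2} :=
    (hφ.1.norm.aemeasurable.pow_const 2).nullMeasurableSet_preimage measurableSet_Ioi
  have hfin : volume {x | a < ‖φ x‖ ^ 2} ≠ ⊤ := by
    refine ne_top_of_le_ne_top ((integrable_norm_sq hφ).measure_norm_ge_lt_top ha).ne
      (measure_mono fun x hx => ?_)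
    have hx : a < ‖φ x‖ ^ 2 := hx
    simpa using hx.le
  have h1 := setIntegral_le_Gam hξ hξ01 hφ hh.le {x | a < ‖φ x‖ ^ 2} hs (f := fun _ => b)
    (integrableOn_const hfin) fun x hx => by
      have hx : a < ‖φ x‖ ^ 2 := hx
      refine hG _ ?_
      rw [div_mul_eq_mul_div, le_div_iff₀ ha]
      exact mul_le_mul_of_nonneg_left hx.le hu₀.le
  have h2 := h1.trans (Gam_le_of_calG_le hξ hξ01 hφ hD hδ hh)
  rw [setIntegral_const, smul_eq_mul] at h2
  rw [← ENNReal.ofReal_toReal hfin]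
  refine ENNReal.ofReal_le_ofReal ?_
  rw [le_div_iff₀ hb]
  exact h2

/-- If `𝒢(φ; d)` is small, then cutting off the small values of `φ` changes neither the norm nor
the energy by much and leaves a support of measure not much larger than `d / ν`, whence a lower
bound for the energy. The three errors are measured by the same parameter `t`. -/
theorem exists_energy_lower_bound (hd : 1 ≤ d) (hξ : AEMeasurable ξ P)
    (hξ01 : ∀ᵐ w ∂P, 0 ≤ ξ w ∧ ξ w ≤ 1) (hμ : 0 < ∫ w, ξ w ∂P) {p : ℝ} (hp0 : 0 < p)
    (hp : P.real {w | ξ w = 0} ≤ p) {ν : ℝ} (hν : ν = Real.log (1 / p)) (hν0 : 0 < ν) {α : ℝ}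
    (hα : 0 < α) {t : ℝ} (ht : 0 < t) :
    ∃ δ > 0, ∀ (φ : Space d → Space d) (g : Space d → Space d →L[ℝ] Space d),
      HasH1Gradient φ g → normSq φ = 1 → calG P ξ φ d ≤ δ →
      (1 / (d / ν * (1 + t))) ^ (2 / d : ℝ) * C d α * (1 - t) ≤ (1 + t) * energy α g := by
  have hd0 : (0 : ℝ) < d := by exact_mod_cast hd
  obtain ⟨κ, hκ, hcut⟩ := exists_cutoff_energy_le (d := d) hα ht
  set c := (∫ w, ξ w ∂P) / 2 with hc
  have hc0 : 0 < c := by positivity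
  -- `b` is the level below which the mass of `φ` is at most `t`, `a` the level of the cutoff.
  set b := c * t / (2 * d) with hbdef
  have hb : 0 < b := by positivity
  set a := b / (2 * Real.exp (1 / κ)) with hadef
  have ha : 0 < a := by positivity
  have hab : 2 * a * Real.exp (1 / κ) = b := by
    rw [hadef]
    field_simp
  set ν' := ν / (1 + t / 2) with hν'def
  have hν'0 : 0 < ν' := by positivity
  have hν' : ν' < Real.log (1 / p) := by
    rw [← hν, hν'def]
    exact div_lt_self hν0 (by linarith)
  obtain ⟨u₀, hu₀, hG⟩ := exists_le_G hξ hξ01 hp0 hp hν'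
  refine ⟨min (c * t / 2) (d * t / 4 * a / u₀ / (1 + t)), by positivity, fun φ g h h1 hδ => ?_⟩
  set m := d / ν * (1 + t) with hm
  have hm0 : 0 < m := by positivity
  obtain ⟨g', hg', he⟩ := hcut a ha φ g h
  have hδ1 := hδ.trans (min_le_left _ _)
  have hδ2 := hδ.trans (min_le_right _ _)
  have hmass : ∫ x in {x | ‖φ x‖ ^ 2 ≤ b}, ‖φ x‖ ^ 2 ≤ t := by
    refine (setIntegral_norm_sq_le hξ hξ01 hμ h.memLp hd0.le hδ1 hb).trans_eq ?_
    rw [← hc, hbdef]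
    field_simp
    ring
  have hnorm : 1 - t ≤ normSq fun x => cutoff a κ (φ x) := by
    have hs := nullMeasurableSet_norm_sq_le h.memLp b
    have hsplit := integral_add_compl₀ hs (integrable_norm_sq h.memLp)
    have h2 : ∫ x in {x | ‖φ x‖ ^ 2 ≤ b}ᶜ, ‖φ x‖ ^ 2
        = ∫ x in {x | ‖φ x‖ ^ 2 ≤ b}ᶜ, ‖cutoff a κ (φ x)‖ ^ 2 := by
      refine setIntegral_congr_ae₀ hs.compl (Eventually.of_forall fun x hx => ?_)
      have hx : b < ‖φ x‖ ^ 2 := not_le.1 hx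
      rw [cutoff_eq_self ha hκ (hab.trans_le hx.le)]
    have h3 : ∫ x in {x | ‖φ x‖ ^ 2 ≤ b}ᶜ, ‖cutoff a κ (φ x)‖ ^ 2
        ≤ normSq fun x => cutoff a κ (φ x) :=
      setIntegral_le_integral (integrable_norm_sq hg'.memLp)
        (Eventually.of_forall fun x => by positivity)
    change _ + _ = normSq φ at hsplit
    linarith
  have hvol : volume {x | cutoff a κ (φ x) ≠ 0} ≤ ENNReal.ofReal m := by
    refine (measure_mono fun x hx => lt_norm_sq_of_cutoff_ne_zero ha hκ hx).trans
      ((measure_lt_norm_sq_le hξ hξ01 h.memLp hd0.le hδ2 ha hν'0 hu₀ hG).trans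
        (ENNReal.ofReal_le_ofReal ?_))
    rw [div_le_iff₀ hν'0]
    have e1 : u₀ / a * (d * t / 4 * a / u₀ / (1 + t)) = d * t / 4 / (1 + t) := by
      field_simp
    have e2 : m * ν' = d * ((1 + t) / (1 + t / 2)) := by
      rw [hm, hν'def]
      field_simp
    have e3 : 1 + t / 4 / (1 + t) ≤ (1 + t) / (1 + t / 2) := by
      rw [le_div_iff₀ (by positivity), div_div, add_mul, div_mul_eq_mul_div, one_mul,
        ← le_sub_iff_add_le', div_le_iff₀ (by positivity)]
      nlinarith
    rw [e1, e2]
    calc (d : ℝ) + d * t / 4 / (1 + t) = d * (1 + t / 4 / (1 + t)) := by ring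
      _ ≤ _ := by gcongr
  refine le_trans ?_ ((C_mul_normSq_le_energy hd hα hg' hm0 hvol).trans he)
  exact mul_le_mul_of_nonneg_left hnorm (mul_nonneg (by positivity) (C_nonneg hα))

theorem energy_add_mul_calG_nonneg (hξ : AEMeasurable ξ P) (hξ01 : ∀ᵐ w ∂P, 0 ≤ ξ w ∧ ξ w ≤ 1)
    {α β : ℝ} (hα : 0 < α) (hβ : 0 ≤ β) {φ : Space d → Space d} {g : Space d → Space d →L[ℝ] Space d}
    (h : HasH1Gradient φ g) : 0 ≤ energy α g + β * calG P ξ φ d :=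
  add_nonneg (energy_nonneg hα g)
    (mul_nonneg hβ (calG_nonneg hξ hξ01 h.memLp (Nat.cast_nonneg d)))

theorem Cab_nonneg (hξ : AEMeasurable ξ P) (hξ01 : ∀ᵐ w ∂P, 0 ≤ ξ w ∧ ξ w ≤ 1) {α β : ℝ}
    (hα : 0 < α) (hβ : 0 ≤ β) : 0 ≤ Cab P ξ d α β := by
  refine Real.sInf_nonneg ?_
  rintro _ ⟨φ, g, h, -, rfl⟩
  exact energy_add_mul_calG_nonneg hξ hξ01 hα hβ h

theorem exists_normalized_comp_smul {φ : Space d → Space d} (hN : 0 < normSq φ) {r : ℝ}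
    (hr : 0 < r) : ∃ c ≠ 0, c ^ 2 * (r ^ d)⁻¹ = (normSq φ)⁻¹ ∧
      normSq (fun x => c • φ (r • x)) = 1 := by
  have hc : Real.sqrt (r ^ d / normSq φ) ^ 2 = r ^ d / normSq φ := Real.sq_sqrt (by positivity)
  have hrd : 0 < r ^ d := by positivity
  have h : Real.sqrt (r ^ d / normSq φ) ^ 2 * (r ^ d)⁻¹ = (normSq φ)⁻¹ := by
    rw [hc]
    field_simp
  refine ⟨Real.sqrt (r ^ d / normSq φ), by positivity, h, ?_⟩
  rw [normSq_comp_smul φ hr, h, inv_mul_cancel₀ hN.ne']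

theorem exists_hasH1Gradient_normSq_eq_one (hd : 1 ≤ d) :
    ∃ (φ : Space d → Space d) (g : Space d → Space d →L[ℝ] Space d),
      HasH1Gradient φ g ∧ normSq φ = 1 := by
  obtain ⟨φ, g, h, h1⟩ := exists_hasH1Gradient_volume_eq_one hd
  obtain ⟨c, -, -, hc⟩ := exists_normalized_comp_smul
    (normSq_pos h.memLp (by simp [h1])) one_pos
  exact ⟨_, _, h.comp_smul one_pos c, hc⟩

/-- The upper bound: rescaling a field admissible for `𝒞_α` to a support of measure `d / ν` makes
`𝒢(·; d)` non-positive, because `G ≤ ν`. -/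
theorem Cab_le (hd : 1 ≤ d) (hξ : AEMeasurable ξ P) (hξ01 : ∀ᵐ w ∂P, 0 ≤ ξ w ∧ ξ w ≤ 1)
    {p : ℝ} (hp0 : 0 < p) (hp : p ≤ P.real {w | ξ w = 0}) {ν : ℝ} (hν : ν = Real.log (1 / p))
    (hν0 : 0 < ν) {α β : ℝ} (hα : 0 < α) (hβ : 0 ≤ β) :
    Cab P ξ d α β ≤ (ν / d) ^ (2 / d : ℝ) * C d α := by
  have hd0 : (0 : ℝ) < d := by exact_mod_cast hd
  have hk : 0 < (ν / d) ^ (2 / d : ℝ) := by positivity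
  rw [← div_le_iff₀' hk]
  obtain ⟨φ₀, g₀, h₀, h₀1⟩ := exists_hasH1Gradient_volume_eq_one hd
  refine le_csInf ⟨_, φ₀, g₀, h₀, h₀1, rfl⟩ ?_
  rintro _ ⟨φ, g, h, h1, rfl⟩
  rw [div_le_iff₀' hk]
  have hN := normSq_pos h.memLp (by simp [h1])
  have hνd : 0 < ν / d := by positivity
  set r := (ν / d) ^ (1 / d : ℝ) with hrdef
  have hr : 0 < r := by positivity
  have hrd : r ^ d = ν / d := by
    rw [hrdef, one_div, Real.rpow_inv_natCast_pow hνd.le (by omega)]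
  have hr2 : r ^ 2 = (ν / d) ^ (2 / d : ℝ) := by
    rw [hrdef, ← Real.rpow_natCast, ← Real.rpow_mul hνd.le]
    congr 1
    push_cast
    ring
  obtain ⟨c, hc, hc2, hn⟩ := exists_normalized_comp_smul hN hr
  have hψ := h.comp_smul hr c
  have hvol : volume {x | c • φ (r • x) ≠ 0} = ENNReal.ofReal (d / ν) := by
    rw [volume_ne_zero_comp_smul φ hr hc, h1, mul_one, hrd, inv_div]
  have hcalG : calG P ξ (fun x => c • φ (r • x)) d ≤ 0 := by
    have : Nonempty (Set.Ioi (0 : ℝ)) := ⟨⟨1, Set.mem_Ioi.2 one_pos⟩⟩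
    refine ciSup_le fun ⟨s, hs⟩ => ?_
    have hs : 0 < s := hs
    refine mul_nonpos_of_nonneg_of_nonpos (inv_nonneg.2 hs.le) (sub_nonpos.2 ?_)
    set A : Set (Space d) := {x | c • φ (r • x) ≠ 0} with hA
    have hsupp : Gam P ξ s (fun x => c • φ (r • x))
        = ∫ x in A, G P ξ (s * ‖c • φ (r • x)‖ ^ 2) := by
      refine (setIntegral_eq_integral_of_forall_compl_eq_zero fun x hx => ?_).symm
      have hx : c • φ (r • x) = 0 := not_not.1 hx
      simp [hx, G]
    have hAT : volume A ≠ ⊤ := by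
      rw [hvol]
      exact ENNReal.ofReal_ne_top
    rw [hsupp]
    calc ∫ x in A, G P ξ (s * ‖c • φ (r • x)‖ ^ 2) ≤ ∫ _ in A, ν :=
          setIntegral_mono (integrable_G hξ hξ01 hψ.memLp hs.le).integrableOn
            (integrableOn_const hAT) fun x =>
              (G_le_log_one_div hξ hξ01 hp0 hp (by positivity)).trans_eq hν.symm
      _ = d := by
          rw [setIntegral_const, smul_eq_mul, Measure.real, hvol,
            ENNReal.toReal_ofReal (by positivity)]
          field_simp
  have hle : Cab P ξ d α β ≤ energy α (fun x => (c * r) • g (r • x))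
      + β * calG P ξ (fun x => c • φ (r • x)) d := by
    refine csInf_le ⟨0, ?_⟩ ⟨_, _, hψ, hn, rfl⟩
    rintro _ ⟨φ, g, h, -, rfl⟩
    exact energy_add_mul_calG_nonneg hξ hξ01 hα hβ h
  refine hle.trans ?_
  rw [energy_comp_smul α g hr c, ← hr2]
  have := mul_nonpos_of_nonneg_of_nonpos hβ hcalG
  have e : c ^ 2 * r ^ 2 * (r ^ d)⁻¹ * energy α g = r ^ 2 * ((normSq φ)⁻¹ * energy α g) := by
    rw [← hc2]
    ring
  linarith

/-- The lower bound: either `𝒢(φ; d)` is small and the energy is bounded from below, or the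
penalty `β 𝒢(φ; d)` is large. -/
theorem eventually_lt_Cab (hd : 1 ≤ d) (hξ : AEMeasurable ξ P)
    (hξ01 : ∀ᵐ w ∂P, 0 ≤ ξ w ∧ ξ w ≤ 1) (hμ : 0 < ∫ w, ξ w ∂P) {p : ℝ} (hp0 : 0 < p)
    (hp : P.real {w | ξ w = 0} ≤ p) {ν : ℝ} (hν : ν = Real.log (1 / p)) (hν0 : 0 < ν) {α : ℝ}
    (hα : 0 < α) {K : ℝ} (hK : K < (ν / d) ^ (2 / d : ℝ) * C d α) :
    ∀ᶠ β : ℝ in atTop, K < Cab P ξ d α β := by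
  have hd0 : (0 : ℝ) < d := by exact_mod_cast hd
  have hlim : Tendsto (fun t : ℝ => (1 / (d / ν * (1 + t))) ^ (2 / d : ℝ) * C d α * (1 - t)
      / (1 + t)) (𝓝[>] 0) (𝓝 ((ν / d) ^ (2 / d : ℝ) * C d α)) := by
    have hc : ContinuousAt (fun t : ℝ => (1 / (d / ν * (1 + t))) ^ (2 / d : ℝ) * C d α * (1 - t)
        / (1 + t)) 0 := by
      have h1 : ContinuousAt (fun t : ℝ => 1 / (d / ν * (1 + t))) 0 :=
        continuousAt_const.div (by fun_prop) (by positivity)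
      exact (((h1.rpow_const (Or.inr (by positivity))).mul continuousAt_const).mul
        (by fun_prop)).div (by fun_prop) (by norm_num)
    have h0 := hc.tendsto
    simp only [add_zero, mul_one, sub_zero, div_one, one_div_div] at h0
    exact h0.mono_left nhdsWithin_le_nhds
  obtain ⟨K', hKK', hK'⟩ := exists_between hK
  obtain ⟨t, htK, ht⟩ := ((hlim.eventually_const_lt hK').and self_mem_nhdsWithin).exists
  have ht : 0 < t := ht
  obtain ⟨δ, hδ, hlow⟩ := exists_energy_lower_bound hd hξ hξ01 hμ hp0 hp hν hν0 hα ht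
  filter_upwards [eventually_ge_atTop (K' / δ), eventually_ge_atTop 0] with β hβ hβ0
  refine hKK'.trans_le ?_
  obtain ⟨φ₀, g₀, h₀, h₀1⟩ := exists_hasH1Gradient_normSq_eq_one hd
  refine le_csInf ⟨_, φ₀, g₀, h₀, h₀1, rfl⟩ ?_
  rintro _ ⟨φ, g, h, h1, rfl⟩
  have hG0 : 0 ≤ calG P ξ φ d := calG_nonneg hξ hξ01 h.memLp (Nat.cast_nonneg d)
  rcases le_total (calG P ξ φ d) δ with hle | hge
  · have h2 := hlow φ g h h1 hle
    rw [lt_div_iff₀ (by linarith)] at htK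
    have h3 : K' ≤ energy α g :=
      le_of_mul_le_mul_right (by linarith) (show 0 < 1 + t by linarith)
    have := mul_nonneg hβ0 hG0
    linarith
  · rw [div_le_iff₀ hδ] at hβ
    have := mul_le_mul_of_nonneg_left hge hβ0
    have := energy_nonneg hα g
    linarith

end Limit

end StokesPE

theorem lemma3p1 {d : ℕ} (hd : 1 ≤ d)
    {Ω : Type*} [MeasurableSpace Ω] (P : Measure Ω) [IsProbabilityMeasure P]
    (ξ : Ω → ℝ) (hξ : AEMeasurable ξ P) (hξ01 : ∀ᵐ w ∂P, 0 ≤ ξ w ∧ ξ w ≤ 1)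
    (hμ : 0 < ∫ w, ξ w ∂P)
    (p : ℝ) (hp0 : 0 < p) (hp1 : p ≤ 1) (hp : P.real {w | ξ w = 0} ≤ p)
    (ν : ℝ) (hν : ν = Real.log (1 / p))
    (α : ℝ) (hα : 0 < α) :
    (P.real {w | ξ w = 0} = p →
      Tendsto (fun β : ℝ => StokesPE.Cab P ξ d α β) atTop
        (𝓝 ((ν / d) ^ (2 / d : ℝ) * StokesPE.C d α))) ∧
    (∀ ε : ℝ, 0 < ε → ∀ᶠ β : ℝ in atTop,
      (ν / d) ^ (2 / d : ℝ) * StokesPE.C d α - ε < StokesPE.Cab P ξ d α β) := by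
  have hd0 : (0 : ℝ) < d := by exact_mod_cast hd
  have hlow : ∀ ε : ℝ, 0 < ε → ∀ᶠ β : ℝ in atTop,
      (ν / d) ^ (2 / d : ℝ) * StokesPE.C d α - ε < StokesPE.Cab P ξ d α β := by
    intro ε hε
    rcases hp1.eq_or_lt with rfl | hp1
    · have h0 : (ν / d) ^ (2 / d : ℝ) = 0 := by
        rw [hν, one_div_one, Real.log_one, zero_div, Real.zero_rpow (by positivity)]
      filter_upwards [eventually_ge_atTop 0] with β hβ
      have := StokesPE.Cab_nonneg (d := d) hξ hξ01 hα hβ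
      rw [h0, zero_mul]
      linarith
    · have hν0 : 0 < ν := by
        rw [hν]
        exact Real.log_pos (one_lt_one_div hp0 hp1)
      exact StokesPE.eventually_lt_Cab hd hξ hξ01 hμ hp0 hp hν hν0 hα (sub_lt_self _ hε)
  refine ⟨fun hpe => ?_, hlow⟩
  -- `p = 1` would force `ξ = 0` almost surely.
  have hp1' : p < 1 := by
    refine hp1.lt_of_ne ?_
    rintro rfl
    have hm : NullMeasurableSet {w | ξ w = 0} P :=
      hξ.nullMeasurableSet_preimage (measurableSet_singleton 0)
    have h1 : P {w | ξ w = 0} = 1 := by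
      rw [← ENNReal.ofReal_toReal (measure_ne_top P {w | ξ w = 0})]
      exact (congrArg ENNReal.ofReal hpe).trans ENNReal.ofReal_one
    have h0 : ξ =ᵐ[P] 0 := (prob_compl_eq_zero_iff₀ hm).2 h1
    rw [integral_congr_ae h0] at hμ
    simp at hμ
  have hν0 : 0 < ν := by
    rw [hν]
    exact Real.log_pos (one_lt_one_div hp0 hp1')
  refine tendsto_order.2 ⟨fun K hK => ?_, fun K hK => ?_⟩
  · exact StokesPE.eventually_lt_Cab hd hξ hξ01 hμ hp0 hp hν hν0 hα hK
  · filter_upwards [eventually_ge_atTop 0] with β hβ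
    exact (StokesPE.Cab_le hd hξ hξ01 hp0 hpe.ge hν hν0 hα hβ).trans_lt hK
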